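/- Let $r,n\ge 1$ and let $G_{r,n}=\mathbb{Z}_r\wr S_n$ be the group of colored permutations: its elements are the pairs $\pi=(z,\tau)$ with $z\in\mathbb{Z}_r^n$, $\tau\in S_n$, and $\pi$ acts on $\Sigma=\{i^{[j]}: 1\le i\le n,\ j\in\mathbb Z_r=\{0,\dots,r-1\}\}$ by $\pi(i^{[j]})=\tau(i)^{[j+z_{\tau(i)}]}$, colors being added modulo $r$. Order $\Sigma$ by $1^{[r-1]}<\cdots<n^{[r-1]}<1^{[r-2]}<\cdots<n^{[r-2]}<\cdots<1^{[0]}<\cdots<n^{[0]}$. The excedance matrix $M(\pi)=(t_i^j)$ has columns $i=1,\dots,n$ and rows $j=r-1,\dots,0$ (from top to bottom), with $t_i^j=b$ if $\pi(i^{[j]})>i^{[j]}$ and $t_i^j=a$ otherwise. The word associated with an $r\times n$ matrix over $\{a,b\}$ is obtained by reading its entries row by row, from left to right, omitting the last entry; $w_\pi$ is the word associated with $M(\pi)$. For $w\in\{a,b\}^{rn-1}$ let $[w]=\#\{\pi\in G_{r,n}: w_\pi=w\}$. For an $r\times n$ matrix $M=(t_i^j)$ over $\{a,b\}$ with associated word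 $w$, let $\Psi(w)=w'_1\cdots w'_{n-1}$, where $w'_i=a$ if all entries of column $i$ are $a$, $w'_i=b$ if they are all $b$, and $w'_i=a+b$ otherwise. Let $[\Psi(w)]$ be the number of $\sigma\in S_n$ such that for each $i\in\{1,\dots,n-1\}$: $\sigma(i)\le i$ if $w'_i=a$, and $\sigma(i)>i$ if $w'_i=b$ (there is no condition at $i$ if $w'_i=a+b$). Write $\Psi(w)=a^{n_1}x_1a^{n_2}x_2\cdots x_ka^{n_{k+1}}$ with $n_i\ge 0$ and $x_i\in\{b,a+b\}$, and put ${\bf n}(w)=(n_1,\dots,n_{k+1})$, ${\bf 1}=(1,\dots,1)$ and $I(w)=\{i\in\{1,\dots,k\}: x_i=a+b\}$. Let $$R_k=\{{\bf r}=(r_1,\dots,r_{k+1}) : r_1=1,\ r_{i+1}-r_i\in\{0,1\}\text{ for }1\le i\le k,\ r_{i+1}-r_i=1\text{ if }i\in I(w)\},$$ $h({\bf r})=\#\{i\in\{1,\dots,k\}: r_i=r_{i+1}\}$ and ${\bf r}^{{\bf n}(w)+{\bf 1}}=\prod_{i=1}^{k+1}r_i^{n_i+1}$. Theorem. If $w$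 is the word of some colored permutation, that is, $w=w_\pi$ for some $\pi\in G_{r,n}$, then $$[w]=[\Psi(w)]=\sum_{{\bf r}\in R_k}(-1)^{h({\bf r})}\,{\bf r}^{{\bf n}(w)+{\bf 1}}.$$ The second equality holds for the word $w$ of every $r\times n$ matrix over $\{a,b\}$, whether or not $w$ comes from a colored permutation. -/

import Mathlib

namespace ColoredExc

/-- The letters of excedance words. -/
inductive Letter
  | a
  | b
  deriving DecidableEq

/-- The letters `a`, `b` and `a+b`; the last one, `ab`, means "either of `a`, `b`". -/
inductive ELetter
  | a
  | b
  | ab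
  deriving DecidableEq

/-- The group `G_{r,n} = ℤ_r ≀ S_n` of colored permutations: pairs `(z, τ)`. -/
@[ext]
structure ColoredPerm (r n : ℕ) where
  z : Fin n → ZMod r
  τ : Equiv.Perm (Fin n)

namespace ColoredPerm

variable {r n : ℕ}

instance : Mul (ColoredPerm r n) :=
  ⟨fun π σ => ⟨fun i => π.z i + σ.z (π.τ.symm i), π.τ * σ.τ⟩⟩

instance : One (ColoredPerm r n) := ⟨⟨fun _ => 0, 1⟩⟩

instance : Inv (ColoredPerm r n) := ⟨fun π => ⟨fun i => -π.z (π.τ i), π.τ⁻¹⟩⟩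

@[simp] theorem mul_z (π σ : ColoredPerm r n) (i : Fin n) :
    (π * σ).z i = π.z i + σ.z (π.τ.symm i) := rfl

@[simp] theorem mul_τ (π σ : ColoredPerm r n) : (π * σ).τ = π.τ * σ.τ := rfl

@[simp] theorem one_z (i : Fin n) : (1 : ColoredPerm r n).z i = 0 := rfl

@[simp] theorem one_τ : (1 : ColoredPerm r n).τ = 1 := rfl

@[simp] theorem inv_z (π : ColoredPerm r n) (i : Fin n) : (π⁻¹).z i = -π.z (π.τ i) := rfl

@[simp] theorem inv_τ (π : ColoredPerm r n) : (π⁻¹).τ = π.τ⁻¹ := rfl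

instance : Group (ColoredPerm r n) :=
  Group.ofLeftAxioms
    (fun π σ ρ => by
      ext i
      · simp [add_assoc, Equiv.Perm.mul_def]
      · simp)
    (fun π => by
      ext i
      · simp [← Equiv.Perm.inv_def]
      · simp)
    (fun π => by
      ext i
      · simp [← Equiv.Perm.inv_def]
      · simp)

/-- A letter `i^{[α]}` of the colored alphabet `Σ` is the pair `(i, α)`. A colored permutation
acts on `Σ` by `i^{[α]} ↦ τ(i)^{[α + z_{τ(i)}]}` (this is its complete notation). -/
instance : MulAction (ColoredPerm r n) (Fin n × ZMod r) where
  smul π x := (π.τ x.1, x.2 + π.z (π.τ x.1))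
  one_smul x := by
    change ((1 : ColoredPerm r n).τ x.1, x.2 + (1 : ColoredPerm r n).z _) = x
    simp
  mul_smul π σ x := by
    change ((π * σ).τ x.1, x.2 + (π * σ).z ((π * σ).τ x.1)) =
      (π.τ (σ.τ x.1), x.2 + σ.z (σ.τ x.1) + π.z (π.τ (σ.τ x.1)))
    simp [add_comm, add_left_comm]

end ColoredPerm

/-- The strict color order on `Σ`:
`1^{[r-1]} < ⋯ < n^{[r-1]} < 1^{[r-2]} < ⋯ < n^{[r-2]} < ⋯ < 1^{[0]} < ⋯ < n^{[0]}`. -/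
def ColorLT {r n : ℕ} (x y : Fin n × ZMod r) : Prop :=
  y.2.val < x.2.val ∨ (x.2 = y.2 ∧ x.1 < y.1)

open Classical in
/-- The excedance matrix `M(π)`. Its rows from top to bottom belong to the colors
`r-1, r-2, …, 0`, so row `p` belongs to the color `r-1-p`. -/
noncomputable def excMatrix {r n : ℕ} (π : ColoredPerm r n) : Matrix (Fin r) (Fin n) Letter :=
  fun p i =>
    let x : Fin n × ZMod r := (i, ((p.rev : ℕ) : ZMod r))
    if ColorLT x (π • x) then Letter.b else Letter.a

/-- The word associated with a matrix: read it row by row, from left to right, ignoring the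
last place. -/
def matrixWord {r n : ℕ} (M : Matrix (Fin r) (Fin n) Letter) : List Letter :=
  ((List.finRange r).flatMap fun p => List.ofFn (M p)).dropLast

/-- The excedance word `w_π` of a colored permutation. -/
noncomputable def excWord {r n : ℕ} (π : ColoredPerm r n) : List Letter :=
  matrixWord (excMatrix π)

/-- `[w]`: the number of `π ∈ G_{r,n}` with excedance word `w`. -/
noncomputable def bracket (r n : ℕ) (w : List Letter) : ℕ :=
  Nat.card {π : ColoredPerm r n // excWord π = w}

/-- The excedance word, of length `n-1`, of an ordinary permutation. -/
def permWord {n : ℕ} (σ : Equiv.Perm (Fin n)) : List Letter :=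
  (List.ofFn fun i => if i < σ i then Letter.b else Letter.a).dropLast

/-- Which letters are allowed at a place marked by `a`, `b` or `a+b`. -/
def ELetter.Allows : ELetter → Letter → Prop
  | .a, x => x = Letter.a
  | .b, x => x = Letter.b
  | .ab, _ => True

/-- `[v]` for a word `v` in `a`, `b`, `a+b`: the number of `σ ∈ S_n` whose excedance word agrees
with `v`, where the places marked `a+b` are disregarded. -/
noncomputable def permBracket (n : ℕ) (v : List ELetter) : ℕ :=
  Nat.card {σ : Equiv.Perm (Fin n) // List.Forall₂ ELetter.Allows v (permWord σ)}

/-- A column is collapsed to `a` or `b` if it is constant, and to `a+b` otherwise. -/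
def collapse {r : ℕ} (c : Fin r → Letter) : ELetter :=
  if ∀ p, c p = Letter.a then ELetter.a
  else if ∀ p, c p = Letter.b then ELetter.b
  else ELetter.ab

/-- The map `Ψ`: collapse the columns `1, …, n-1`. -/
def Psi {r n : ℕ} (M : Matrix (Fin r) (Fin n) Letter) : List ELetter :=
  (List.ofFn fun i : Fin n => collapse fun p => M p i).dropLast

/-- The letters `x₁, …, x_k` of `v = a^{n₁} x₁ a^{n₂} x₂ ⋯ x_k a^{n_{k+1}}` other than `a`. -/
def nonA (v : List ELetter) : List ELetter := v.filter (· ≠ ELetter.a)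

/-- The exponents `n₁, …, n_{k+1}` of `v = a^{n₁} x₁ a^{n₂} x₂ ⋯ x_k a^{n_{k+1}}`. -/
def runs : List ELetter → List ℕ
  | [] => [0]
  | ELetter.a :: v => (runs v).modifyHead (· + 1)
  | ELetter.b :: v => 0 :: runs v
  | ELetter.ab :: v => 0 :: runs v

theorem runs_length (v : List ELetter) : (runs v).length = (nonA v).length + 1 := by
  induction v with
  | nil => rfl
  | cons x v ih => cases x <;> simp_all [runs, nonA]

/-- The vector `n(v) = (n₁, …, n_{k+1})`. -/
def nVec (v : List ELetter) (i : Fin ((nonA v).length + 1)) : ℕ :=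
  (runs v).get (i.cast (runs_length v).symm)

/-- The condition defining `R_k`: `r₁ = 1`, each step `r_{i+1} - r_i` is `0` or `1`, and it is `1`
if `x_i = a+b`. -/
def IsLatticeVector (v : List ELetter) (ρ : Fin ((nonA v).length + 1) → ℕ) : Prop :=
  ρ 0 = 1 ∧ ∀ i : Fin (nonA v).length,
    (ρ i.succ = ρ i.castSucc ∨ ρ i.succ = ρ i.castSucc + 1) ∧
    ((nonA v).get i = ELetter.ab → ρ i.succ = ρ i.castSucc + 1)

theorem finite_latticeVectors (v : List ELetter) : {ρ | IsLatticeVector v ρ}.Finite := by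
  refine (Fintype.piFinset fun _ : Fin ((nonA v).length + 1) =>
    Finset.range ((nonA v).length + 2)).finite_toSet.subset ?_
  rintro ρ ⟨h0, h1⟩
  have key : ∀ i : Fin ((nonA v).length + 1), ρ i ≤ (i : ℕ) + 1 := by
    intro i
    induction i using Fin.induction with
    | zero => simp [h0]
    | succ i ih =>
      have := (h1 i).1
      simp only [Fin.val_castSucc, Fin.val_succ] at ih ⊢
      omega
  simp only [Finset.mem_coe, Fintype.mem_piFinset, Finset.mem_range]
  intro i
  have := key i
  omega

/-- The finite set `R_k` of lattice vectors. -/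
noncomputable def latticeVectors (v : List ELetter) :
    Finset (Fin ((nonA v).length + 1) → ℕ) :=
  (finite_latticeVectors v).toFinset

/-- `h(r)`: the number of `i ∈ {1, …, k}` with `r_i = r_{i+1}`. -/
def hSteps {k : ℕ} (ρ : Fin (k + 1) → ℕ) : ℕ :=
  (Finset.univ.filter fun i : Fin k => ρ i.castSucc = ρ i.succ).card

end ColoredExc

namespace ColoredExc

/-! Let c = z(τ(i)) be the color added in column i of M(π). If c ≠ 0, the entry for color j is b
exactly when j + c wraps around, that is, when j ≥ r - c, whatever τ is: the column is mixed and has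
c letters b. If c = 0, the column is constant, equal to b iff i < τ(i). So the word determines every
c and restricts τ only at the constant columns, which are the places where Ψ keeps a condition. With
the colors c fixed, π ↦ τ is therefore a bijection between the two sets counted
(`excWord_eq_excWord_iff`, `bracket_eq_permBracket`).

For the sum, read Ψ(w) from the left, with d unconstrained places already in front. A letter a+b
makes its place unconstrained as well. A letter a leaves d + 1 values for its place, and place and
value can be deleted without disturbing the later conditions. A letter b is a+b minus a. This is the
recursion of `weight`, with m = d + 1 (`card_fits`). The lattice sum started at m obeys the same
recursion: a letter a raises the first exponent, any other letter splits the sum by its first step,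
and a flat step contributes the sign (`stepSum_eq_weight`). -/

/-! ### Lattice sums -/

/-- The number of permutations compatible with the word `v`, divided by the `(m - 1)!` arrangements
of `m - 1` unconstrained places put in front of `v`. -/
def weight : List ELetter → ℤ → ℤ
  | [], m => m
  | .a :: v, m => m * weight v m
  | .b :: v, m => m * weight v (m + 1) - m * weight v m
  | .ab :: v, m => m * weight v (m + 1)

/-- The vectors `ρ` with `ρ 0 = m` whose steps are `0` or `1`, and `1` where `x` is `a+b`. -/
def stepVectors : (k : ℕ) → (Fin k → ELetter) → ℕ → Finset (Fin (k + 1) → ℕ)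
  | 0, _, m => {fun _ => m}
  | k + 1, x, m =>
    ((if x 0 = ELetter.ab then ∅ else stepVectors k (Fin.tail x) m) ∪
      stepVectors k (Fin.tail x) (m + 1)).image (fun ρ => (Fin.cons m ρ : Fin (k + 2) → ℕ))

theorem apply_zero_of_mem_stepVectors {k : ℕ} {x : Fin k → ELetter} {m : ℕ}
    {ρ : Fin (k + 1) → ℕ} (h : ρ ∈ stepVectors k x m) : ρ 0 = m := by
  cases k with
  | zero => simp_all [stepVectors]
  | succ k =>
    simp only [stepVectors, Finset.mem_image] at h
    obtain ⟨ρ', -, rfl⟩ := h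
    rfl

theorem mem_stepVectors {k : ℕ} {x : Fin k → ELetter} {m : ℕ} {ρ : Fin (k + 1) → ℕ} :
    ρ ∈ stepVectors k x m ↔ ρ 0 = m ∧ ∀ i : Fin k,
      (ρ i.succ = ρ i.castSucc ∨ ρ i.succ = ρ i.castSucc + 1) ∧
      (x i = ELetter.ab → ρ i.succ = ρ i.castSucc + 1) := by
  induction k generalizing m with
  | zero =>
    simp only [stepVectors, Finset.mem_singleton, IsEmpty.forall_iff, and_true]
    constructor
    · rintro rfl; rfl
    · intro h; ext i; rw [Fin.fin_one_eq_zero i, h]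
  | succ k ih =>
    have hcons : ρ ∈ stepVectors (k + 1) x m ↔ ρ 0 = m ∧
        ((x 0 ≠ ELetter.ab ∧ Fin.tail ρ ∈ stepVectors k (Fin.tail x) m) ∨
          Fin.tail ρ ∈ stepVectors k (Fin.tail x) (m + 1)) := by
      simp only [stepVectors, Finset.mem_image, Finset.mem_union]
      constructor
      · rintro ⟨ρ', h, rfl⟩
        refine ⟨rfl, ?_⟩
        rw [Fin.tail_cons]
        split_ifs at h with hx <;> simp_all
      · rintro ⟨rfl, h⟩
        refine ⟨Fin.tail ρ, ?_, Fin.cons_self_tail ρ⟩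
        split_ifs with hx <;> simp_all
    rw [hcons, ih, ih, Fin.forall_fin_succ]
    have h1 : (Fin.tail ρ) 0 = ρ (Fin.succ 0) := rfl
    have h2 : ∀ i : Fin k, (Fin.tail ρ) i.succ = ρ i.succ.succ := fun _ => rfl
    have h3 : ∀ i : Fin k, (Fin.tail ρ) i.castSucc = ρ i.succ.castSucc := fun _ => rfl
    have h4 : ∀ i : Fin k, (Fin.tail x) i = x i.succ := fun _ => rfl
    simp only [h1, h2, h3, h4, Fin.castSucc_zero]
    constructor
    · rintro ⟨rfl, ⟨hx, h, h'⟩ | ⟨h, h'⟩⟩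
      · exact ⟨rfl, ⟨Or.inl h, fun hh => absurd hh hx⟩, h'⟩
      · exact ⟨rfl, ⟨Or.inr h, fun _ => h⟩, h'⟩
    · rintro ⟨rfl, ⟨h, h0⟩, h'⟩
      refine ⟨rfl, ?_⟩
      by_cases hx : x 0 = ELetter.ab
      · exact Or.inr ⟨h0 hx, h'⟩
      · exact h.imp (fun h => ⟨hx, h, h'⟩) (fun h => ⟨h, h'⟩)

/-- The signed sum of the monomials `ρ ^ (ν + 1)` over the step vectors `ρ` starting at `m`. -/
def stepSum (k : ℕ) (x : Fin k → ELetter) (ν : Fin (k + 1) → ℕ) (m : ℕ) : ℤ :=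
  ∑ ρ ∈ stepVectors k x m, (-1 : ℤ) ^ hSteps ρ * ∏ i, (ρ i : ℤ) ^ (ν i + 1)

theorem hSteps_cons {k : ℕ} (m : ℕ) (ρ : Fin (k + 1) → ℕ) :
    hSteps (Fin.cons m ρ : Fin (k + 2) → ℕ) = (if m = ρ 0 then 1 else 0) + hSteps ρ := by
  simp only [hSteps, Finset.card_filter, Fin.sum_univ_succ (n := k)]
  rfl

theorem stepSum_zero (x : Fin 0 → ELetter) (ν : Fin 1 → ℕ) (m : ℕ) :
    stepSum 0 x ν m = (m : ℤ) ^ (ν 0 + 1) := by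
  simp [stepSum, stepVectors, hSteps]

/-- Split by the second coordinate, m or m + 1. The flat step costs a sign and is forbidden at a+b.
-/
theorem stepSum_succ (k : ℕ) (x : Fin (k + 1) → ELetter) (ν : Fin (k + 2) → ℕ) (m : ℕ) :
    stepSum (k + 1) x ν m = (m : ℤ) ^ (ν 0 + 1) *
      (stepSum k (Fin.tail x) (Fin.tail ν) (m + 1) -
        if x 0 = ELetter.ab then 0 else stepSum k (Fin.tail x) (Fin.tail ν) m) := by
  have hdisj : Disjoint (if x 0 = ELetter.ab then ∅ else stepVectors k (Fin.tail x) m)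
      (stepVectors k (Fin.tail x) (m + 1)) := by
    rw [Finset.disjoint_left]
    intro ρ h h'
    split_ifs at h
    · simp at h
    · have := apply_zero_of_mem_stepVectors h
      have := apply_zero_of_mem_stepVectors h'
      omega
  have hlow : ∀ ρ ∈ stepVectors k (Fin.tail x) m,
      (-1 : ℤ) ^ hSteps (Fin.cons m ρ : Fin (k + 2) → ℕ) *
        ∏ i, ((Fin.cons m ρ : Fin (k + 2) → ℕ) i : ℤ) ^ (ν i + 1) =
      -((m : ℤ) ^ (ν 0 + 1) * ((-1 : ℤ) ^ hSteps ρ * ∏ i, (ρ i : ℤ) ^ (Fin.tail ν i + 1))) := by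
    intro ρ h
    rw [hSteps_cons, apply_zero_of_mem_stepVectors h, Fin.prod_univ_succ]
    simp only [if_true, Fin.cons_zero, Fin.cons_succ, Fin.tail, pow_add]
    ring
  have hhigh : ∀ ρ ∈ stepVectors k (Fin.tail x) (m + 1),
      (-1 : ℤ) ^ hSteps (Fin.cons m ρ : Fin (k + 2) → ℕ) *
        ∏ i, ((Fin.cons m ρ : Fin (k + 2) → ℕ) i : ℤ) ^ (ν i + 1) =
      (m : ℤ) ^ (ν 0 + 1) * ((-1 : ℤ) ^ hSteps ρ * ∏ i, (ρ i : ℤ) ^ (Fin.tail ν i + 1)) := by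
    intro ρ h
    rw [hSteps_cons, apply_zero_of_mem_stepVectors h, Fin.prod_univ_succ, if_neg (by omega)]
    simp only [Fin.cons_zero, Fin.cons_succ, Fin.tail, zero_add]
    ring
  rw [stepSum, stepVectors, Finset.sum_image (fun _ _ _ _ h => Fin.cons_right_injective _ h),
    Finset.sum_union hdisj, Finset.sum_congr rfl hhigh, ← Finset.mul_sum]
  split_ifs with hx
  · simp [stepSum]
  · rw [Finset.sum_congr rfl hlow, Finset.sum_neg_distrib, ← Finset.mul_sum]
    simp only [stepSum]
    ring

theorem stepSum_add_single (k : ℕ) (x : Fin k → ELetter) (ν ν' : Fin (k + 1) → ℕ) (m : ℕ)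
    (h0 : ν' 0 = ν 0 + 1) (h : ∀ i : Fin k, ν' i.succ = ν i.succ) :
    stepSum k x ν' m = m * stepSum k x ν m := by
  cases k with
  | zero => rw [stepSum_zero, stepSum_zero, h0]; ring
  | succ k =>
    have ht : Fin.tail ν' = Fin.tail ν := funext h
    rw [stepSum_succ, stepSum_succ, h0, ht]; ring

theorem nVec_cons_a (v : List ELetter) :
    nVec (ELetter.a :: v) 0 = nVec v 0 + 1 ∧
      ∀ i : Fin (nonA v).length, nVec (ELetter.a :: v) i.succ = nVec v i.succ := by
  constructor
  · exact (List.getElem_modifyHead _).trans (dif_pos rfl)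
  · intro i
    exact (List.getElem_modifyHead _).trans (dif_neg (Nat.succ_ne_zero i))

theorem stepSum_eq_weight (v : List ELetter) (m : ℕ) :
    stepSum (nonA v).length (nonA v).get (nVec v) m = weight v m := by
  induction v generalizing m with
  | nil => exact (stepSum_zero _ _ _).trans (by simp [weight, nVec, runs])
  | cons y v ih =>
    cases y with
    | a =>
      obtain ⟨h0, h⟩ := nVec_cons_a v
      exact (stepSum_add_single _ _ (nVec v) _ m h0 h).trans (congrArg ((m : ℤ) * ·) (ih m))
    | b =>
      refine (stepSum_succ (nonA v).length _ _ m).trans ?_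
      have h1 := ih m
      have h2 := ih (m + 1)
      -- At a letter other than a, `runs` prepends 0; hence the exponent 0 + 1, and the remaining
      -- exponents are those of `v`.
      change (m : ℤ) ^ (0 + 1) * (stepSum (nonA v).length (nonA v).get (nVec v) (m + 1) -
        stepSum (nonA v).length (nonA v).get (nVec v) m) = _
      rw [h1, h2, weight]
      push_cast
      ring
    | ab =>
      refine (stepSum_succ (nonA v).length _ _ m).trans ?_
      have h2 := ih (m + 1)
      change (m : ℤ) ^ (0 + 1) * (stepSum (nonA v).length (nonA v).get (nVec v) (m + 1) -
        0) = _
      rw [h2, weight]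
      push_cast
      ring

theorem sum_latticeVectors (v : List ELetter) :
    ∑ ρ ∈ latticeVectors v, (-1 : ℤ) ^ hSteps ρ * ∏ i, (ρ i : ℤ) ^ (nVec v i + 1) =
      weight v 1 := by
  have h : latticeVectors v = stepVectors _ (nonA v).get 1 := by
    ext ρ
    rw [mem_stepVectors, latticeVectors, Set.Finite.mem_toFinset]
    rfl
  rw [h]
  exact (stepSum_eq_weight v 1).trans (by rw [Nat.cast_one])

/-! ### Counting permutations -/

/-- The condition that a letter puts on the value `t` taken at the place `s`. -/
def ELetter.Holds (x : ELetter) (s t : ℕ) : Prop :=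
  match x with
  | .a => t ≤ s
  | .b => s < t
  | .ab => True

/-- The permutation `σ` satisfies the conditions of `v` at the places `d, d + 1, …`. -/
def Fits (d : ℕ) (v : List ELetter) {N : ℕ} (σ : Equiv.Perm (Fin N)) : Prop :=
  ∀ (i : Fin N) (j : ℕ) (x : ELetter), (i : ℕ) = d + j → v[j]? = some x → x.Holds i (σ i)

theorem fits_cons {d : ℕ} {y : ELetter} {v : List ELetter} {N : ℕ} (p : Fin N) (hp : (p : ℕ) = d)
    (σ : Equiv.Perm (Fin N)) :
    Fits d (y :: v) σ ↔ y.Holds p (σ p) ∧ Fits (d + 1) v σ := by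
  constructor
  · intro h
    refine ⟨h p 0 y (by omega) rfl, fun i j x hi hx => h i (j + 1) x (by omega) ?_⟩
    simpa using hx
  · rintro ⟨h0, h⟩ i j x hi hx
    cases j with
    | zero =>
      obtain rfl : i = p := Fin.ext (by omega)
      simp only [List.getElem?_cons_zero, Option.some.injEq] at hx
      exact hx ▸ h0
    | succ j => exact h i j x (by omega) (by simpa using hx)

/-- Permutations with a prescribed value correspond to permutations of one place less. -/
def permFixEquiv {N : ℕ} (p q : Fin (N + 1)) :
    {σ : Equiv.Perm (Fin (N + 1)) // σ p = q} ≃ Equiv.Perm (Fin N) :=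
  ((Equiv.equivCongr (finSuccEquiv' p) (Equiv.refl _)).subtypeEquiv fun σ => by simp).trans
    ((Equiv.optionSubtype q).trans
      (Equiv.equivCongr (Equiv.refl _) (finSuccAboveEquiv q).symm))

theorem succAbove_permFixEquiv {N : ℕ} (p q : Fin (N + 1))
    (σ : {σ : Equiv.Perm (Fin (N + 1)) // σ p = q}) (i : Fin N) :
    q.succAbove (permFixEquiv p q σ i) = σ.1 (p.succAbove i) := by
  have h : ∀ y : {x : Fin (N + 1) // x ≠ q},
      q.succAbove ((finSuccAboveEquiv q).symm y) = y := fun y =>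
    congrArg Subtype.val ((finSuccAboveEquiv q).apply_symm_apply y)
  refine (h _).trans ?_
  change σ.1 ((finSuccEquiv' p).symm (some i)) = _
  rw [finSuccEquiv'_symm_some]

/-- Deleting place p and value q ≤ p lowers each later place by 1. Values above q drop by 1 too;
values below q stay, but they lie below every place concerned both before and after, so no
comparison changes. -/
theorem fits_permFixEquiv {N d : ℕ} (v : List ELetter) {p q : Fin (N + 1)} (hp : (p : ℕ) = d)
    (hq : q ≤ p) (σ : {σ : Equiv.Perm (Fin (N + 1)) // σ p = q}) :
    Fits (d + 1) v σ.1 ↔ Fits d v (permFixEquiv p q σ) := by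
  have key : ∀ (i : Fin N) (x : ELetter), d ≤ i →
      (x.Holds i.succ (σ.1 i.succ) ↔ x.Holds i (permFixEquiv p q σ i)) := by
    intro i x hi
    have h := succAbove_permFixEquiv p q σ i
    rw [Fin.succAbove_of_le_castSucc p i (by simp [Fin.le_def]; omega)] at h
    rw [← h]
    have hqd : (q : ℕ) ≤ d := hp ▸ hq
    have hv : (i.succ : ℕ) = i + 1 := rfl
    rcases lt_or_ge (permFixEquiv p q σ i).castSucc q with hlt | hge
    · rw [Fin.succAbove_of_castSucc_lt _ _ hlt]
      have : ((permFixEquiv p q σ i : Fin N) : ℕ) < q := hlt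
      cases x <;> simp only [ELetter.Holds, Fin.val_castSucc] <;> omega
    · rw [Fin.succAbove_of_le_castSucc _ _ hge]
      cases x <;> simp [ELetter.Holds]
  constructor
  · intro h i j x hi hx
    exact (key i x (by omega)).1 (h i.succ j x (by simp [hi]; omega) hx)
  · intro h i j x hi hx
    obtain ⟨i, rfl⟩ : ∃ i' : Fin N, i = i'.succ :=
      ⟨i.pred (by rintro rfl; simp at hi; omega), by simp⟩
    have hi' : (i : ℕ) = d + j := by simp at hi; omega
    exact (key i x (by omega)).2 (h i j x hi' hx)

theorem card_fits_cons_a {N d : ℕ} (v : List ELetter) (hd : d < N + 1) :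
    Nat.card {σ : Equiv.Perm (Fin (N + 1)) // Fits d (ELetter.a :: v) σ} =
      (d + 1) * Nat.card {σ : Equiv.Perm (Fin N) // Fits d v σ} := by
  let p : Fin (N + 1) := ⟨d, hd⟩
  have hp : (p : ℕ) = d := rfl
  let f : {σ : Equiv.Perm (Fin (N + 1)) // Fits d (ELetter.a :: v) σ} →
      {q : Fin (N + 1) // q ≤ p} × {σ : Equiv.Perm (Fin N) // Fits d v σ} := fun σ =>
    (⟨σ.1 p, ((fits_cons p hp σ.1).1 σ.2).1⟩, ⟨permFixEquiv p (σ.1 p) ⟨σ.1, rfl⟩,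
      (fits_permFixEquiv v hp ((fits_cons p hp σ.1).1 σ.2).1 ⟨σ.1, rfl⟩).1
        ((fits_cons p hp σ.1).1 σ.2).2⟩)
  have hf : Function.Bijective f := by
    constructor
    -- The type of `permFixEquiv p q` depends on q, so q = q' is eliminated before injectivity is
    -- used.
    · have key : ∀ (q q' : Fin (N + 1)) (s : {σ : Equiv.Perm (Fin (N + 1)) // σ p = q})
          (s' : {σ : Equiv.Perm (Fin (N + 1)) // σ p = q'}), q = q' →
          permFixEquiv p q s = permFixEquiv p q' s' → s.1 = s'.1 := by
        rintro q q' s s' rfl h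
        rw [(permFixEquiv p q).injective h]
      intro σ σ' h
      obtain ⟨h₁, h₂⟩ := Prod.mk.inj h
      exact Subtype.ext (key _ _ _ _ (Subtype.mk.inj h₁) (Subtype.mk.inj h₂))
    · rintro ⟨⟨q, hq⟩, τ, hτ⟩
      obtain ⟨⟨σ, rfl⟩, rfl⟩ := (permFixEquiv p q).surjective τ
      exact ⟨⟨σ, (fits_cons p hp σ).2 ⟨hq, (fits_permFixEquiv v hp hq ⟨σ, rfl⟩).2 hτ⟩⟩, rfl⟩
  rw [Nat.card_congr (Equiv.ofBijective f hf), Nat.card_prod]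
  congr 1
  rw [Nat.card_eq_fintype_card, Fintype.card_subtype]
  have : (Finset.univ.filter fun q : Fin (N + 1) => q ≤ p) = Finset.Iic p := by
    ext; simp
  rw [this, Fin.card_Iic]

/-- The summand 1 in `N` is the last place, which carries no letter. For the empty word this gives
(d + 1)! = d! · (d + 1). -/
theorem card_fits (v : List ELetter) (d N : ℕ) (hN : N = d + v.length + 1) :
    (Nat.card {σ : Equiv.Perm (Fin N) // Fits d v σ} : ℤ) = d.factorial * weight v (d + 1) := by
  induction v generalizing d N with
  | nil =>
    have h : ∀ σ : Equiv.Perm (Fin N), Fits d [] σ := fun σ i j x _ hx => by simp at hx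
    rw [Nat.card_congr (Equiv.subtypeUnivEquiv h), Nat.card_perm, Nat.card_fin, hN]
    simp [Nat.factorial_succ, weight]
    ring
  | cons y v ih =>
    obtain ⟨N, rfl⟩ : ∃ N', N = N' + 1 := ⟨d + v.length + 1, by simpa [add_assoc] using hN⟩
    have hN' : N = d + v.length + 1 := by simp at hN; omega
    have hd : d < N + 1 := by omega
    have ha : (Nat.card {σ : Equiv.Perm (Fin (N + 1)) // Fits d (ELetter.a :: v) σ} : ℤ) =
        d.factorial * ((d + 1) * weight v (d + 1)) := by
      rw [card_fits_cons_a v hd]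
      push_cast
      rw [ih d N hN']
      ring
    have hab : (Nat.card {σ : Equiv.Perm (Fin (N + 1)) // Fits (d + 1) v σ} : ℤ) =
        d.factorial * ((d + 1) * weight v (d + 1 + 1)) := by
      rw [ih (d + 1) (N + 1) (by omega), Nat.factorial_succ]
      push_cast
      ring
    have hcons := fun y => fits_cons (y := y) (v := v) (⟨d, hd⟩ : Fin (N + 1)) rfl
    cases y with
    | a => rw [ha, weight]
    | ab =>
      rw [weight, ← hab]
      congr 1
      exact Nat.card_congr (Equiv.subtypeEquivRight fun σ => by
        rw [hcons]; simp [ELetter.Holds])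
    | b =>
      rw [weight, mul_sub, ← hab, ← ha, eq_sub_iff_add_eq]
      norm_cast
      classical
      simp only [Nat.card_eq_fintype_card, Fintype.card_subtype]
      rw [← Finset.card_union_of_disjoint]
      · congr 1
        ext σ
        simp only [Finset.mem_union, Finset.mem_filter, Finset.mem_univ, true_and, hcons,
          ELetter.Holds, ← or_and_right]
        exact ⟨fun h => h.2, fun h => ⟨lt_or_ge _ _, h⟩⟩
      · rw [Finset.disjoint_filter]
        intro σ _ h h'
        rw [hcons] at h h'
        exact absurd h.1 (not_lt.2 h'.1)

theorem forall₂_permWord {n : ℕ} (v : List ELetter) (hv : v.length = n - 1)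
    (σ : Equiv.Perm (Fin n)) :
    List.Forall₂ ELetter.Allows v (permWord σ) ↔ Fits 0 v σ := by
  have hl : (permWord σ).length = n - 1 := by simp [permWord]
  have hall : ∀ (x : ELetter) (i : Fin n),
      x.Allows (if i < σ i then Letter.b else Letter.a) ↔ x.Holds i (σ i) := by
    intro x i
    by_cases h : i < σ i
    · have h' : (i : ℕ) < σ i := h
      cases x <;> simp [ELetter.Allows, ELetter.Holds, h]
    · have h' : (σ i : ℕ) ≤ i := not_lt.1 h
      cases x <;> simp [ELetter.Allows, ELetter.Holds, h, h']
  rw [List.forall₂_iff_get]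
  constructor
  · rintro ⟨-, h⟩ i j x hi hx
    obtain ⟨hj, rfl⟩ := List.getElem?_eq_some_iff.1 hx
    have h' := h j hj (by omega)
    obtain rfl : j = i := by omega
    rw [← hall]
    simpa [permWord, List.getElem_dropLast] using h'
  · intro h
    refine ⟨by omega, fun j h₁ h₂ => ?_⟩
    have h' := h ⟨j, by omega⟩ j v[j] (by simp) (List.getElem?_eq_getElem h₁)
    rw [← hall] at h'
    simpa [permWord, List.getElem_dropLast] using h'

theorem permBracket_eq_weight {n : ℕ} (hn : 0 < n) (v : List ELetter) (hv : v.length = n - 1) :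
    (permBracket n v : ℤ) = weight v 1 := by
  rw [permBracket, Nat.card_congr (Equiv.subtypeEquivRight fun σ => forall₂_permWord v hv σ),
    card_fits v 0 n (by omega)]
  simp

/-! ### Colored permutations -/

theorem matrixWord_eq_iff {r n : ℕ} (M M' : Matrix (Fin r) (Fin n) Letter) :
    matrixWord M = matrixWord M' ↔
      ∀ (p : Fin r) (i : Fin n), (p : ℕ) * n + i + 1 < r * n → M p i = M' p i := by
  -- Place k of the word is the entry in row k / n and column k % n.
  have hw : ∀ M : Matrix (Fin r) (Fin n) Letter, matrixWord M =
      (List.ofFn fun k : Fin (r * n) => M k.divNat k.modNat).dropLast := by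
    intro M
    rw [matrixWord, List.ofFn_mul, List.flatMap_def, List.ofFn_eq_map]
    congr 3
    funext p
    congr 1
    funext i
    have hi := i.2
    congr 1
    · ext
      simp [Fin.divNat, Nat.add_div_of_dvd_right, Nat.div_eq_of_lt hi, i.pos]
    · ext
      simp [Fin.modNat, Nat.mod_eq_of_lt hi]
  rw [hw, hw]
  constructor
  · intro h p i hlt
    have h' := congrArg (fun l => l[(p : ℕ) * n + i]?) h
    have hi := i.2
    have e1 : ((p : ℕ) * n + i) / n = p := by
      rw [add_comm, Nat.add_mul_div_right _ _ i.pos, Nat.div_eq_of_lt hi, zero_add]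
    have e2 : ((p : ℕ) * n + i) % n = i := by
      rw [add_comm, Nat.add_mul_mod_self_right, Nat.mod_eq_of_lt hi]
    have hlt' : (p : ℕ) * n + i < r * n - 1 := by omega
    simpa [List.getElem?_eq_getElem, List.getElem_dropLast, hlt', Fin.divNat, Fin.modNat, e1, e2]
      using h'
  · intro h
    refine List.ext_getElem (by simp) fun k hk hk' => ?_
    simp only [List.length_dropLast, List.length_ofFn] at hk
    simp only [List.getElem_dropLast, List.getElem_ofFn]
    apply h
    have := Nat.div_add_mod' k n
    simp only [Fin.coe_divNat, Fin.coe_modNat]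
    omega

theorem excMatrix_eq_b_iff {r n : ℕ} [NeZero r] (π : ColoredPerm r n) (p : Fin r) (i : Fin n) :
    excMatrix π p i = Letter.b ↔
      r ≤ (p.rev : ℕ) + (π.z (π.τ i)).val ∨ ((π.z (π.τ i)).val = 0 ∧ i < π.τ i) := by
  have hsmul : π • ((i, ((p.rev : ℕ) : ZMod r)) : Fin n × ZMod r) =
      (π.τ i, ((p.rev : ℕ) : ZMod r) + π.z (π.τ i)) := rfl
  have hj : (((p.rev : ℕ) : ZMod r)).val = p.rev := ZMod.val_cast_of_lt p.rev.2
  have hc := ZMod.val_lt (π.z (π.τ i))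
  have hp := p.rev.2
  simp only [excMatrix, ColorLT, hsmul]
  simp only [ZMod.val_add, hj, ZMod.val_eq_zero, left_eq_add]
  have : ((p.rev : ℕ) + (π.z (π.τ i)).val) % r < p.rev ↔
      r ≤ (p.rev : ℕ) + (π.z (π.τ i)).val := by
    rcases lt_or_ge ((p.rev : ℕ) + (π.z (π.τ i)).val) r with h | h
    · rw [Nat.mod_eq_of_lt h]; omega
    · rw [Nat.mod_eq_sub_mod h, Nat.mod_eq_of_lt (by omega)]; omega
  simp only [this, ite_eq_left_iff, reduceCtorEq, imp_false, not_not]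

theorem Letter.eq_of_eq_b_iff {x y : Letter} (h : x = Letter.b ↔ y = Letter.b) : x = y := by
  cases x <;> cases y <;> simp_all

/-- The entry omitted from the word belongs to the largest letter of Σ, which has no excedance.
Hence the word determines the whole excedance matrix. -/
theorem excMatrix_eq_a {r n : ℕ} [NeZero r] (π : ColoredPerm r n) (p : Fin r) (i : Fin n)
    (h : r * n ≤ (p : ℕ) * n + i + 1) : excMatrix π p i = Letter.a := by
  have hb : excMatrix π p i ≠ Letter.b := by
    rw [Ne, excMatrix_eq_b_iff]
    have hi := i.2
    have hp := p.2
    have hlast : (p : ℕ) + 1 = r := by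
      by_contra hne
      have : (p + 2) * n ≤ r * n := Nat.mul_le_mul_right n (by omega)
      rw [add_mul] at this
      omega
    have hn : (i : ℕ) + 1 = n := by
      have : r * n = p * n + n := by rw [← Nat.succ_mul, Nat.succ_eq_add_one, hlast]
      omega
    have hrev : (p.rev : ℕ) = 0 := by rw [Fin.val_rev]; omega
    have hc := ZMod.val_lt (π.z (π.τ i))
    have hτ := (π.τ i).2
    rw [hrev, Fin.lt_def]
    omega
  cases hx : excMatrix π p i
  · rfl
  · exact absurd hx hb

theorem excWord_eq_iff {r n : ℕ} [NeZero r] (π π' : ColoredPerm r n) :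
    excWord π = excWord π' ↔ ∀ p i, excMatrix π p i = excMatrix π' p i := by
  rw [excWord, excWord, matrixWord_eq_iff]
  refine ⟨fun h p i => ?_, fun h p i _ => h p i⟩
  rcases lt_or_ge ((p : ℕ) * n + i + 1) (r * n) with hlt | hge
  · exact h p i hlt
  · rw [excMatrix_eq_a π p i hge, excMatrix_eq_a π' p i hge]

/-- The color of the image of `i` can be read off the column `i` of the excedance matrix. -/
theorem color_eq_of_column_eq {r n : ℕ} [NeZero r] {π π' : ColoredPerm r n} {i : Fin n}
    (h : ∀ p, excMatrix π p i = excMatrix π' p i) : π.z (π.τ i) = π'.z (π'.τ i) := by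
  have hr : 0 < r := Nat.pos_of_ne_zero (NeZero.ne r)
  have key : ∀ j < r, (r ≤ j + (π.z (π.τ i)).val ∨ ((π.z (π.τ i)).val = 0 ∧ i < π.τ i) ↔
      r ≤ j + (π'.z (π'.τ i)).val ∨ ((π'.z (π'.τ i)).val = 0 ∧ i < π'.τ i)) := by
    intro j hj
    have := h (Fin.rev ⟨j, hj⟩)
    have := congrArg (· = Letter.b) this
    simpa only [excMatrix_eq_b_iff, Fin.rev_rev, eq_iff_iff] using this
  apply ZMod.val_injective
  have hc := ZMod.val_lt (π.z (π.τ i))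
  have hc' := ZMod.val_lt (π'.z (π'.τ i))
  generalize (π.z (π.τ i)).val = c at *
  generalize (π'.z (π'.τ i)).val = c' at *
  have h0 := key 0 hr
  -- A zero color gives a constant column; a nonzero one gives different entries at colors 0 and r -
  -- 1. For two nonzero colors, the thresholds r - c and r - c' must agree.
  rcases Nat.eq_zero_or_pos c with rfl | hpos <;> rcases Nat.eq_zero_or_pos c' with rfl | hpos'
  · rfl
  · have h1 := key (r - 1) (by omega)
    grind
  · have h1 := key (r - 1) (by omega)
    grind
  · have h1 := key (r - c) (by omega)
    have h2 := key (r - c') (by omega)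
    omega

theorem collapse_column {r n : ℕ} [NeZero r] (π : ColoredPerm r n) (i : Fin n) :
    collapse (fun p => excMatrix π p i) =
      if π.z (π.τ i) = 0 then (if i < π.τ i then ELetter.b else ELetter.a) else ELetter.ab := by
  have hr : 0 < r := Nat.pos_of_ne_zero (NeZero.ne r)
  have ha : ∀ x : Letter, x = Letter.a ↔ x ≠ Letter.b := by intro x; cases x <;> simp
  have hlast : ((Fin.rev (⟨0, hr⟩ : Fin r)).rev : ℕ) = 0 := by simp
  have htop : ((⟨0, hr⟩ : Fin r).rev : ℕ) = r - 1 := by simp [Fin.val_rev]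
  have hc := ZMod.val_lt (π.z (π.τ i))
  simp only [← ZMod.val_eq_zero (π.z (π.τ i))]
  have A : (∀ p, excMatrix π p i = Letter.a) ↔ (π.z (π.τ i)).val = 0 ∧ ¬ i < π.τ i := by
    simp only [ha, Ne, excMatrix_eq_b_iff]
    constructor
    · intro h
      have h1 := h ⟨0, hr⟩
      rw [htop] at h1
      by_cases hz : (π.z (π.τ i)).val = 0
      · exact ⟨hz, fun hh => h1 (Or.inr ⟨hz, hh⟩)⟩
      · exact absurd (Or.inl (by omega)) h1
    · rintro ⟨hz, hi⟩ p (h | h)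
      · have := p.rev.2; omega
      · exact hi h.2
  have B : (∀ p, excMatrix π p i = Letter.b) ↔ (π.z (π.τ i)).val = 0 ∧ i < π.τ i := by
    simp only [excMatrix_eq_b_iff]
    constructor
    · intro h
      have h1 := h (Fin.rev ⟨0, hr⟩)
      rw [hlast] at h1
      exact h1.resolve_left (by omega)
    · exact fun h p => Or.inr h
  unfold collapse
  simp only [A, B]
  split_ifs <;> simp_all

/-- The condition that `Ψ` puts on a permutation, place by place. -/
theorem forall₂_Psi {r n : ℕ} (M : Matrix (Fin r) (Fin n) Letter) (σ : Equiv.Perm (Fin n)) :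
    List.Forall₂ ELetter.Allows (Psi M) (permWord σ) ↔ ∀ i : Fin n, (i : ℕ) + 1 < n →
      (collapse fun p => M p i).Allows (if i < σ i then Letter.b else Letter.a) := by
  rw [List.forall₂_iff_get]
  simp only [Psi, permWord, List.length_dropLast, List.length_ofFn, List.get_eq_getElem,
    List.getElem_dropLast, List.getElem_ofFn, true_and]
  exact ⟨fun h i hi => h i (by omega) (by omega), fun h j h₁ h₂ => h ⟨j, by omega⟩ (by simp; omega)⟩

/-- A colored permutation has the same excedance word as `π₀` if and only if its colors are those
of `π₀`, place by place, and its underlying permutation obeys the collapsed columns. -/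
theorem excWord_eq_excWord_iff {r n : ℕ} [NeZero r] (π π₀ : ColoredPerm r n) :
    excWord π = excWord π₀ ↔ (∀ i, π.z (π.τ i) = π₀.z (π₀.τ i)) ∧
      ∀ i : Fin n, (i : ℕ) + 1 < n → (collapse fun p => excMatrix π₀ p i).Allows
        (if i < π.τ i then Letter.b else Letter.a) := by
  rw [excWord_eq_iff]
  constructor
  · intro h
    refine ⟨fun i => color_eq_of_column_eq fun p => h p i, fun i _ => ?_⟩
    simp only [← h]
    rw [collapse_column]
    split_ifs <;> simp [ELetter.Allows]
  · rintro ⟨hz, hσ⟩ p i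
    apply Letter.eq_of_eq_b_iff
    rw [excMatrix_eq_b_iff, excMatrix_eq_b_iff, hz i]
    refine or_congr_right (and_congr_right fun h0 => ?_)
    rcases lt_or_ge ((i : ℕ) + 1) n with hi | hi
    · have h := hσ i hi
      rw [collapse_column, if_pos ((ZMod.val_eq_zero _).1 h0)] at h
      by_cases h₁ : i < π.τ i <;> by_cases h₂ : i < π₀.τ i <;>
        simp [ELetter.Allows, h₁, h₂] at h ⊢
    -- In the last column i < τ(i) is impossible, so there is nothing to compare.
    · have h1 := (π.τ i).2
      have h2 := (π₀.τ i).2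
      simp only [Fin.lt_def]
      omega

theorem bracket_eq_permBracket {r n : ℕ} [NeZero r] (M : Matrix (Fin r) (Fin n) Letter)
    (π₀ : ColoredPerm r n) (h₀ : excWord π₀ = matrixWord M) :
    bracket r n (matrixWord M) = permBracket n (Psi M) := by
  -- M may differ from the excedance matrix in the omitted entry, but that lies in the last column,
  -- which Ψ ignores.
  have hM : ∀ i : Fin n, (i : ℕ) + 1 < n → ∀ p, excMatrix π₀ p i = M p i := by
    intro i hi p
    refine (matrixWord_eq_iff _ _).1 h₀ p i ?_
    have : ((p : ℕ) + 1) * n ≤ r * n := Nat.mul_le_mul_right n p.2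
    rw [add_mul] at this
    omega
  have hΨ : ∀ σ : Equiv.Perm (Fin n), List.Forall₂ ELetter.Allows (Psi M) (permWord σ) ↔
      ∀ i : Fin n, (i : ℕ) + 1 < n → (collapse fun p => excMatrix π₀ p i).Allows
        (if i < σ i then Letter.b else Letter.a) := by
    intro σ
    rw [forall₂_Psi]
    exact forall₂_congr fun i hi => by simp only [hM i hi]
  rw [bracket, permBracket, ← h₀]
  refine Nat.card_congr
    { toFun := fun π => ⟨π.1.τ, (hΨ _).2 ((excWord_eq_excWord_iff _ _).1 π.2).2⟩
      -- Colors are indexed by images, so the color that π₀ adds to i is moved to σ(i).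
      invFun := fun σ => ⟨⟨fun k => π₀.z (π₀.τ (σ.1.symm k)), σ.1⟩,
        (excWord_eq_excWord_iff _ _).2 ⟨fun i => by simp, (hΨ _).1 σ.2⟩⟩
      left_inv := ?_
      right_inv := fun σ => rfl }
  rintro ⟨π, hπ⟩
  ext k
  · have := ((excWord_eq_excWord_iff _ _).1 hπ).1 (π.τ.symm k)
    simp only [Equiv.apply_symm_apply] at this
    exact this.symm
  · rfl

end ColoredExc

theorem mainTheorem3 (r n : ℕ) (hr : 0 < r) (hn : 0 < n)
    (M : Matrix (Fin r) (Fin n) ColoredExc.Letter) :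
    ((∃ π : ColoredExc.ColoredPerm r n,
        ColoredExc.excWord π = ColoredExc.matrixWord M) →
      ColoredExc.bracket r n (ColoredExc.matrixWord M) =
        ColoredExc.permBracket n (ColoredExc.Psi M)) ∧
      (ColoredExc.permBracket n (ColoredExc.Psi M) : ℤ) =
        ∑ ρ ∈ ColoredExc.latticeVectors (ColoredExc.Psi M),
          (-1 : ℤ) ^ ColoredExc.hSteps ρ *
            ∏ i, (ρ i : ℤ) ^ (ColoredExc.nVec (ColoredExc.Psi M) i + 1) := by
  have : NeZero r := ⟨hr.ne'⟩
  refine ⟨fun ⟨π₀, h₀⟩ => ColoredExc.bracket_eq_permBracket M π₀ h₀, ?_⟩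
  rw [ColoredExc.sum_latticeVectors]
  exact ColoredExc.permBracket_eq_weight hn _ (by simp [ColoredExc.Psi])
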